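/- Consider a monitored Clifford circuit on $n$ qubits with $\tau$ steps: the system starts in the maximally mixed state $\mu = I/2^n$, and at step $j=1,\dots,\tau$ an (arbitrary) Pauli operator $P'_j$ is measured projectively with outcome $m_j=\pm1$, i.e. $\Pi'_j(m_j)=\frac{I+m_jP'_j}{2}$ is applied, followed by a Clifford unitary $U_j$. Put $K(m)=U_\tau\Pi'_\tau(m_\tau)\cdots U_1\Pi'_1(m_1)$ for a measurement record $m=(m_1,\dots,m_\tau)$, let $\mathrm{Prob}(m)=\mathrm{Tr}[K(m)\mu K(m)^\dagger]$, and, when $\mathrm{Prob}(m)\neq 0$, let $\rho(m)=K(m)\mu K(m)^\dagger/\mathrm{Prob}(m)$ be the output state. Let $P_j=(U_\tau\cdots U_j)P'_j(U_\tau\cdots U_j)^\dagger$ be the time-evolved measured operators. Let $A$ be a set of $n_A$ qubits with complement $B$. For a Pauli operator $P$ (a tensor product of matrices $I,X,Y,Z$) let $C(P)\in\{\pm1\}^\tau$ be the codeword vector with $P P_j = C(P)_j\, P_j P$. Let $E(P_i)\in\{\pm1\}^\tau$ be the error vector with $P_iP_j=E(P_i)_j\,P_jP_i$ for $j\le i$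 and $E(P_i)_j=1$ for $j>i$, and let $\mathcal E$ be the group generated by $E(P_1),\dots,E(P_\tau)$ under componentwise multiplication. The initial information in this dual classical code is called fully recoverable if $e\cdot C(P_A)\neq f\cdot C(Q_A)$ for all $e,f\in\mathcal E$ and all Pauli operators $P_A\neq Q_A$ supported on $A$. Then for every measurement record $m$ with $\mathrm{Prob}(m)\neq 0$, the subsystem $A$ is maximally entangled with $B$ in the output state $\rho(m)$, i.e. $I(A,B)=S_A+S_B-S_{AB}=2n_A$ (von Neumann entropies in bits), if and only if the initial information in the dual classical code is fully recoverable; and it is fully recoverable if and only if $C(P_A)\notin\mathcal E$ for every non-identity Pauli operator $P_A$ supported on $A$. -/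

import Mathlib

open scoped Matrix

noncomputable section

namespace MonitoredClifford

/-- Operators on `n` qubits, as matrices in the computational basis `Fin n → Fin 2`. -/
abbrev Operator (n : ℕ) : Type := Matrix (Fin n → Fin 2) (Fin n → Fin 2) ℂ

/-- The four single-qubit Pauli matrices, labelled by two bits `(x, z)`:
`(0,0) ↦ I`, `(1,0) ↦ X`, `(0,1) ↦ Z`, `(1,1) ↦ Y`. -/
def pauliMatrix (a : ZMod 2 × ZMod 2) : Matrix (Fin 2) (Fin 2) ℂ :=
  if a = (0, 0) then 1
  else if a = (1, 0) then !![0, 1; 1, 0]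
  else if a = (0, 1) then !![1, 0; 0, -1]
  else !![0, -Complex.I; Complex.I, 0]

/-- Labels of the `4 ^ n` Pauli operators (up to phase) on `n` qubits.  The label `0` is the
identity operator. -/
abbrev PauliString (n : ℕ) : Type := Fin n → ZMod 2 × ZMod 2

/-- The tensor product of the single-qubit Pauli matrices named by `p`. -/
def pauliOp {n : ℕ} (p : PauliString n) : Operator n :=
  Matrix.of fun x y => ∏ i, pauliMatrix (p i) (x i) (y i)

/-- The operator of `p` acts as the identity outside the set of qubits `A`. -/
def SupportedOn {n : ℕ} (A : Finset (Fin n)) (p : PauliString n) : Prop :=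
  ∀ i, i ∉ A → p i = 0

/-- Membership in the Pauli group, the Pauli operators with phases `1, i, -1, -i`. -/
def IsPauliGroupElement {n : ℕ} (M : Operator n) : Prop :=
  ∃ (k : ℕ) (p : PauliString n), M = Complex.I ^ k • pauliOp p

/-- A Clifford operator: a unitary which conjugates Pauli operators into the Pauli group. -/
def IsClifford {n : ℕ} (U : Operator n) : Prop :=
  U ∈ Matrix.unitaryGroup (Fin n → Fin 2) ℂ ∧
    ∀ p : PauliString n, IsPauliGroupElement (U * pauliOp p * Uᴴ)

/-- A monitored Clifford circuit on `n` qubits with `τ` steps: step `j` is a projective measurement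
of the Pauli operator `meas j`, followed by the Clifford unitary `gate j`. -/
structure Circuit (n τ : ℕ) where
  meas : Fin τ → PauliString n
  gate : Fin τ → Operator n
  gate_clifford : ∀ j, IsClifford (gate j)

/-- The sign with which two Pauli operators commute: `1` if they commute, `-1` otherwise
(Pauli operators that do not commute anticommute). -/
def commSign {n : ℕ} (P Q : Operator n) : ℤˣ :=
  open Classical in if P * Q = Q * P then 1 else -1

/-- The von Neumann entropy `-Tr (ρ log₂ ρ)` of a Hermitian matrix, in bits. -/
def entropy {ι : Type} [Fintype ι] [DecidableEq ι] (ρ : Matrix ι ι ℂ) (h : ρ.IsHermitian) : ℝ :=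
  (∑ i, Real.negMulLog (h.eigenvalues i)) / Real.log 2

/-- The basis label that is `x` on the qubits of `S` and `z` on the other qubits. -/
def glue {n : ℕ} (S : Finset (Fin n)) (x : S → Fin 2) (z : (Sᶜ : Finset (Fin n)) → Fin 2) :
    Fin n → Fin 2 :=
  fun i => if h : i ∈ S then x ⟨i, h⟩ else z ⟨i, Finset.mem_compl.2 h⟩

/-- The reduced operator on the qubits of `S`: the partial trace over all other qubits. -/
def reduced {n : ℕ} (S : Finset (Fin n)) (ρ : Operator n) : Matrix (S → Fin 2) (S → Fin 2) ℂ :=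
  Matrix.of fun x y => ∑ z : (Sᶜ : Finset (Fin n)) → Fin 2, ρ (glue S x z) (glue S y z)

theorem reduced_isHermitian {n : ℕ} (S : Finset (Fin n)) {ρ : Operator n} (h : ρ.IsHermitian) :
    (reduced S ρ).IsHermitian := by
  ext x y
  simp only [reduced, Matrix.conjTranspose_apply, Matrix.of_apply, star_sum]
  exact Finset.sum_congr rfl fun z _ => h.apply _ _

/-- The mutual information `S_A + S_B - S_{AB}` of a state, with `B` the complement of `A`. -/
def mutualInformation {n : ℕ} (A : Finset (Fin n)) (ρ : Operator n) (h : ρ.IsHermitian) : ℝ :=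
  entropy (reduced A ρ) (reduced_isHermitian A h)
    + entropy (reduced Aᶜ ρ) (reduced_isHermitian Aᶜ h) - entropy ρ h

/-- The maximally mixed state of `n` qubits. -/
def maximallyMixed (n : ℕ) : Operator n := ((2 : ℂ) ^ n)⁻¹ • 1

theorem maximallyMixed_isHermitian (n : ℕ) : (maximallyMixed n).IsHermitian := by
  simp [maximallyMixed, Matrix.IsHermitian, Matrix.conjTranspose_smul]

namespace Circuit

variable {n τ : ℕ} (𝒞 : Circuit n τ)

/-- The projector `(I + m P) / 2` for outcome `m` of the measurement at step `j`. -/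
def projector (j : Fin τ) (m : ℤˣ) : Operator n :=
  (1 / 2 : ℂ) • (1 + ((m : ℤ) : ℂ) • pauliOp (𝒞.meas j))

/-- The operation of the circuit with measurement record `m`: with `Π` for the projectors and `U`
for the gates, the product `U_τ Π_τ ⋯ U_1 Π_1`, earliest step rightmost. -/
def kraus (m : Fin τ → ℤˣ) : Operator n :=
  (List.ofFn fun j => 𝒞.gate j * 𝒞.projector j (m j)).reverse.prod

/-- The probability of the measurement record `m` on the maximally mixed initial state. -/
def prob (m : Fin τ → ℤˣ) : ℝ :=
  (𝒞.kraus m * maximallyMixed n * (𝒞.kraus m)ᴴ).trace.re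

/-- The normalized output state for the measurement record `m`, for the maximally mixed initial
state; meaningful when `prob m ≠ 0`. -/
def outputState (m : Fin τ → ℤˣ) : Operator n :=
  (((𝒞.prob m)⁻¹ : ℝ) : ℂ) • (𝒞.kraus m * maximallyMixed n * (𝒞.kraus m)ᴴ)

theorem outputState_isHermitian (m : Fin τ → ℤˣ) : (𝒞.outputState m).IsHermitian := by
  have h := Matrix.isHermitian_mul_mul_conjTranspose (𝒞.kraus m) (maximallyMixed_isHermitian n)
  unfold outputState Matrix.IsHermitian
  rw [Matrix.conjTranspose_smul, h.eq]
  simp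

/-- The product `U_τ ⋯ U_j` of the gates from step `j` on, latest step leftmost. -/
def laterGates (j : Fin τ) : Operator n :=
  ((List.ofFn 𝒞.gate).drop j).reverse.prod

/-- The time-evolved measured Pauli operator, `meas j` conjugated by `U_τ ⋯ U_j`. -/
def evolved (j : Fin τ) : Operator n :=
  𝒞.laterGates j * pauliOp (𝒞.meas j) * (𝒞.laterGates j)ᴴ

/-- The codeword vector of a Pauli operator: its commutation signs with all time-evolved measured
Pauli operators. -/
def codeword (p : PauliString n) : Fin τ → ℤˣ :=
  fun j => commSign (pauliOp p) (𝒞.evolved j)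

/-- The error vector of step `i`: the commutation signs of the `i`-th time-evolved measured Pauli
operator with the ones of the same and earlier steps, and `1` at all later steps. -/
def errorVector (i : Fin τ) : Fin τ → ℤˣ :=
  fun j => if j ≤ i then commSign (𝒞.evolved i) (𝒞.evolved j) else 1

/-- The error vector set, generated by the error vectors under componentwise multiplication. -/
def errorSet : Subgroup (Fin τ → ℤˣ) :=
  Subgroup.closure (Set.range 𝒞.errorVector)

/-- Full recoverability of the initial information in the dual classical code with input subsystem
`A`: errors never map the codewords of two distinct Pauli operators on `A` to the same vector. -/
def FullyRecoverable (A : Finset (Fin n)) : Prop :=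
  ∀ p q : PauliString n, SupportedOn A p → SupportedOn A q → p ≠ q →
    ∀ e ∈ 𝒞.errorSet, ∀ f ∈ 𝒞.errorSet, e * 𝒞.codeword p ≠ f * 𝒞.codeword q

end Circuit

end MonitoredClifford

end

/-!
Conjugating by the later gates turns the circuit into a sequence of projections
`Π_τ ⋯ Π_1` onto eigenspaces of the time-evolved Pauli operators `P_j`, preceded by a unitary which
leaves the maximally mixed state invariant. The output state is therefore a multiple of
`Π_τ ⋯ Π_1 Π_1 ⋯ Π_τ`.

Such a state `ρ` is a stabilizer state (`IsStabilizerState`): every Pauli operator with nonzero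
expectation value fixes `ρ` up to a scalar. This form of the definition needs no bookkeeping of
signs, and it passes to measured states (`IsStabilizerState.measured`) and to reduced states
(`IsStabilizerState.reduced`). Expanding `ρ` in Pauli operators gives `ρ² = (|S| / 2ⁿ) ρ` for
the stabilizer group `S`, hence the entropy `n - log₂ |S|`, and for the subsystem `A` the entropy
`|A| - log₂ |S_A|`, where `S_A` consists of the stabilizers supported on `A`.

Let `N_A` be the group of Pauli operators on `A` commuting with `S`. Summing the commutation signs
over all pairs of a Pauli operator on `A` and a stabilizer in two ways gives
`|S| |N_A| = 4 ^ |A| |S_B|` (`card_mul_card_centralizer`). So the mutual information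
`log₂ (|S| / (|S_A| |S_B|))` equals `2 |A|` iff `|S_A| |N_A| = 1`, which, since `S_A ⊆ N_A`, means
that no nontrivial Pauli operator on `A` commutes with `S` (`mutualInformation_eq_iff`).

Finally, after a measurement of `P` the Pauli operators commuting with all stabilizers are those `Q`
commuting with `P` for which `Q` or `Q P` commuted with all previous stabilizers
(`commutesWithStabilizer_measured`). Unfolding this over all steps, `Q` commutes with `S` iff for some
exponents `e` the operator `Q ∏_{i > j} P_i ^ e_i` commutes with `P_j` for every `j`. Up to the
trivial factor `i = j` this says that the codeword of `Q` is the product of the error vectors to the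
powers `e_i` (`commutesWithStabilizer_projectorProduct`).
-/

noncomputable section

namespace MonitoredClifford

/-! ### Pauli operators -/

section Pauli

/-- The sign with which two single-qubit Pauli matrices commute, read off from their labels. -/
def qubitSign (a b : ZMod 2 × ZMod 2) : ℤˣ := if a.1 * b.2 = a.2 * b.1 then 1 else -1

theorem qubitSign_add_left : ∀ a b c : ZMod 2 × ZMod 2,
    qubitSign (a + b) c = qubitSign a c * qubitSign b c := by decide

theorem qubitSign_comm : ∀ a b : ZMod 2 × ZMod 2, qubitSign a b = qubitSign b a := by decide

theorem qubitSign_self : ∀ a : ZMod 2 × ZMod 2, qubitSign a a = 1 := by decide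

theorem eq_zero_of_qubitSign : ∀ a : ZMod 2 × ZMod 2, (∀ b, qubitSign b a = 1) → a = 0 := by
  decide

theorem forall_qubit {C : ZMod 2 × ZMod 2 → Prop} (h00 : C (0, 0)) (h10 : C (1, 0))
    (h01 : C (0, 1)) (h11 : C (1, 1)) (a : ZMod 2 × ZMod 2) : C a := by
  have h : ∀ a : ZMod 2 × ZMod 2, a = (0, 0) ∨ a = (1, 0) ∨ a = (0, 1) ∨ a = (1, 1) := by decide
  rcases h a with rfl | rfl | rfl | rfl <;> assumption

@[simp] theorem pauliMatrix_zero_zero : pauliMatrix (0, 0) = 1 := by simp [pauliMatrix]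

@[simp] theorem pauliMatrix_one_zero : pauliMatrix (1, 0) = !![0, 1; 1, 0] := by
  simp [pauliMatrix]

@[simp] theorem pauliMatrix_zero_one : pauliMatrix (0, 1) = !![1, 0; 0, -1] := by
  simp [pauliMatrix]

@[simp] theorem pauliMatrix_one_one :
    pauliMatrix (1, 1) = !![0, -Complex.I; Complex.I, 0] := by
  simp [pauliMatrix]

theorem pauliMatrix_mul_comm (a b : ZMod 2 × ZMod 2) :
    pauliMatrix a * pauliMatrix b =
      ((qubitSign a b : ℤ) : ℂ) • (pauliMatrix b * pauliMatrix a) := by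
  revert a b
  refine forall_qubit (forall_qubit ?_ ?_ ?_ ?_) (forall_qubit ?_ ?_ ?_ ?_)
    (forall_qubit ?_ ?_ ?_ ?_) (forall_qubit ?_ ?_ ?_ ?_) <;>
  simp [qubitSign, Matrix.one_fin_two]

theorem pauliMatrix_mul (a b : ZMod 2 × ZMod 2) :
    ∃ c : ℂ, c ≠ 0 ∧ pauliMatrix a * pauliMatrix b = c • pauliMatrix (a + b) := by
  have h11 : (1 : ZMod 2) + 1 = 0 := by decide
  have hI := Complex.I_ne_zero
  revert a b
  refine forall_qubit (forall_qubit ⟨1, ?_⟩ ⟨1, ?_⟩ ⟨1, ?_⟩ ⟨1, ?_⟩)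
    (forall_qubit ⟨1, ?_⟩ ⟨1, ?_⟩ ⟨-Complex.I, ?_⟩ ⟨Complex.I, ?_⟩)
    (forall_qubit ⟨1, ?_⟩ ⟨Complex.I, ?_⟩ ⟨1, ?_⟩ ⟨-Complex.I, ?_⟩)
    (forall_qubit ⟨1, ?_⟩ ⟨-Complex.I, ?_⟩ ⟨Complex.I, ?_⟩ ⟨1, ?_⟩) <;>
  simp [Matrix.one_fin_two, h11]

theorem pauliMatrix_mul_self (a : ZMod 2 × ZMod 2) : pauliMatrix a * pauliMatrix a = 1 := by
  revert a
  refine forall_qubit ?_ ?_ ?_ ?_ <;> simp [Matrix.one_fin_two]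

theorem pauliMatrix_conjTranspose (a : ZMod 2 × ZMod 2) : (pauliMatrix a)ᴴ = pauliMatrix a := by
  revert a
  refine forall_qubit ?_ ?_ ?_ ?_ <;>
  · ext i j; fin_cases i <;> fin_cases j <;> simp

theorem trace_pauliMatrix {a : ZMod 2 × ZMod 2} (ha : a ≠ 0) : (pauliMatrix a).trace = 0 := by
  revert a
  refine fun {a} => forall_qubit (C := fun a => a ≠ 0 → (pauliMatrix a).trace = 0)
    ?_ ?_ ?_ ?_ a <;> simp [Matrix.trace_fin_two]

/-- The four Pauli matrices form an orthogonal basis of the `2 × 2` matrices: their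
completeness relation. -/
theorem sum_pauliMatrix_mul (x y z w : Fin 2) :
    ∑ a, pauliMatrix a x y * pauliMatrix a z w = if x = w ∧ z = y then 2 else 0 := by
  have h : (Finset.univ : Finset (ZMod 2 × ZMod 2)) = {(0, 0), (1, 0), (0, 1), (1, 1)} := by
    decide
  rw [h, Finset.sum_insert (by decide), Finset.sum_insert (by decide),
    Finset.sum_insert (by decide), Finset.sum_singleton]
  fin_cases x <;> fin_cases y <;> fin_cases z <;> fin_cases w <;> norm_num

theorem add_self_eq_zero_label {ι : Type} (p : ι → ZMod 2 × ZMod 2) : p + p = 0 := by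
  have h : ∀ a : ZMod 2 × ZMod 2, a + a = 0 := by decide
  exact funext fun i => h _

variable {ι : Type} [Fintype ι]

/-- The Pauli operator with label `p` on the qubits of an arbitrary finite set `ι`, so that the
operators of a subsystem are covered as well; for `ι = Fin n` it is `pauliOp`. -/
def pauliTensor (p : ι → ZMod 2 × ZMod 2) : Matrix (ι → Fin 2) (ι → Fin 2) ℂ :=
  Matrix.of fun x y => ∏ i, pauliMatrix (p i) (x i) (y i)

/-- The sign with which the Pauli operators labelled by `p` and `q` commute, read off from the
labels. -/
def pauliSign (p q : ι → ZMod 2 × ZMod 2) : ℤˣ := ∏ i, qubitSign (p i) (q i)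

theorem pauliSign_add_left (p q s : ι → ZMod 2 × ZMod 2) :
    pauliSign (p + q) s = pauliSign p s * pauliSign q s := by
  simp [pauliSign, qubitSign_add_left, Finset.prod_mul_distrib]

theorem pauliSign_comm (p q : ι → ZMod 2 × ZMod 2) : pauliSign p q = pauliSign q p := by
  simp only [pauliSign, qubitSign_comm]

theorem pauliSign_add_right (p q s : ι → ZMod 2 × ZMod 2) :
    pauliSign p (q + s) = pauliSign p q * pauliSign p s := by
  simp only [pauliSign_comm p, pauliSign_add_left]

theorem pauliSign_self (p : ι → ZMod 2 × ZMod 2) : pauliSign p p = 1 := by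
  simp [pauliSign, qubitSign_self]

theorem pauliTensor_conjTranspose (p : ι → ZMod 2 × ZMod 2) :
    (pauliTensor p)ᴴ = pauliTensor p := by
  ext x y
  simp only [pauliTensor, Matrix.conjTranspose_apply, Matrix.of_apply, star_prod]
  exact Finset.prod_congr rfl fun i _ => by
    rw [← Matrix.conjTranspose_apply, pauliMatrix_conjTranspose]

theorem pauliTensor_zero : pauliTensor (0 : ι → ZMod 2 × ZMod 2) = 1 := by
  ext x y
  have h : pauliMatrix 0 = 1 := pauliMatrix_zero_zero
  simp only [pauliTensor, Matrix.of_apply, Pi.zero_apply, h, Matrix.one_apply, funext_iff]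
  rw [Finset.prod_ite_zero]
  simp

variable [DecidableEq ι]

theorem pauliTensor_mul_apply (p q : ι → ZMod 2 × ZMod 2) (x y : ι → Fin 2) :
    (pauliTensor p * pauliTensor q) x y =
      ∏ i, (pauliMatrix (p i) * pauliMatrix (q i)) (x i) (y i) := by
  simp only [pauliTensor, Matrix.mul_apply, Matrix.of_apply, Finset.prod_univ_sum,
    Fintype.piFinset_univ, Finset.prod_mul_distrib]

theorem pauliTensor_mul_comm (p q : ι → ZMod 2 × ZMod 2) :
    pauliTensor p * pauliTensor q =
      ((pauliSign p q : ℤ) : ℂ) • (pauliTensor q * pauliTensor p) := by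
  ext x y
  simp only [pauliTensor_mul_apply, Matrix.smul_apply, pauliMatrix_mul_comm (p _), smul_eq_mul,
    Finset.prod_mul_distrib, pauliSign]
  congr 1
  push_cast
  rfl

theorem pauliTensor_mul (p q : ι → ZMod 2 × ZMod 2) :
    ∃ c : ℂ, c ≠ 0 ∧ pauliTensor p * pauliTensor q = c • pauliTensor (p + q) := by
  choose c hc h using pauliMatrix_mul
  refine ⟨∏ i, c (p i) (q i), Finset.prod_ne_zero_iff.2 fun i _ => hc _ _, ?_⟩
  ext x y
  rw [pauliTensor_mul_apply]
  simp [h, Finset.prod_mul_distrib, pauliTensor]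

theorem pauliTensor_mul_self (p : ι → ZMod 2 × ZMod 2) : pauliTensor p * pauliTensor p = 1 := by
  ext x y
  simp only [pauliTensor_mul_apply, pauliMatrix_mul_self, Matrix.one_apply, funext_iff]
  rw [Finset.prod_ite_zero]
  simp

theorem pauliTensor_ne_zero (p : ι → ZMod 2 × ZMod 2) : pauliTensor p ≠ 0 := fun h =>
  one_ne_zero ((pauliTensor_mul_self p).symm.trans (by rw [h, mul_zero]))

theorem trace_pauliTensor {p : ι → ZMod 2 × ZMod 2} (hp : p ≠ 0) : (pauliTensor p).trace = 0 := by
  obtain ⟨i, hi⟩ := Function.ne_iff.1 hp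
  have h : (pauliTensor p).trace = ∏ i, (pauliMatrix (p i)).trace := by
    simp only [pauliTensor, Matrix.trace, Matrix.diag_apply, Matrix.of_apply,
      Finset.prod_univ_sum, Fintype.piFinset_univ]
  rw [h]
  exact Finset.prod_eq_zero (Finset.mem_univ i) (trace_pauliMatrix hi)

/-- Pauli operators form an orthogonal basis of all operators: the expansion of `R` in it. -/
theorem sum_trace_smul_pauliTensor (R : Matrix (ι → Fin 2) (ι → Fin 2) ℂ) :
    ∑ p, (pauliTensor p * R).trace • pauliTensor p = (2 : ℂ) ^ Fintype.card ι • R := by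
  ext x y
  have key (z w : ι → Fin 2) : ∑ p : ι → ZMod 2 × ZMod 2, pauliTensor p z w * pauliTensor p x y =
      if x = w ∧ z = y then (2 : ℂ) ^ Fintype.card ι else 0 := by
    simp only [pauliTensor, Matrix.of_apply, ← Finset.prod_mul_distrib]
    rw [← Fintype.piFinset_univ,
      ← Finset.prod_univ_sum (fun _ => Finset.univ)
        (fun i a => pauliMatrix a (z i) (w i) * pauliMatrix a (x i) (y i))]
    simp only [sum_pauliMatrix_mul]
    rw [Finset.prod_ite_zero]
    simp only [funext_iff, Finset.prod_const, Finset.card_univ, Finset.mem_univ, true_imp_iff]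
    congr 1
    rw [eq_iff_iff, forall_and]
    constructor <;> rintro ⟨h, k⟩ <;> exact ⟨k, h⟩
  simp only [Matrix.sum_apply, Matrix.smul_apply, smul_eq_mul, Matrix.trace, Matrix.diag_apply,
    Matrix.mul_apply, Finset.sum_mul]
  rw [Finset.sum_comm]
  calc _ = ∑ z, ∑ w, R w z *
        ∑ p : ι → ZMod 2 × ZMod 2, pauliTensor p z w * pauliTensor p x y := by
        refine Finset.sum_congr rfl fun z _ => ?_
        rw [Finset.sum_comm]
        refine Finset.sum_congr rfl fun w _ => ?_
        rw [Finset.mul_sum]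
        exact Finset.sum_congr rfl fun p _ => by ring
    _ = _ := by
        simp only [key]
        rw [Finset.sum_eq_single y, Finset.sum_eq_single x]
        · simp [mul_comm]
        · intro w _ hw
          simp [hw.symm]
        · simp
        · intro z _ hz
          simp [hz]
        · simp

end Pauli
/-! ### Stabilizer states and their entropy -/

section Stabilizer

variable {ι : Type} [Fintype ι] [DecidableEq ι]

/-- The labels of the Pauli operators which, up to a scalar, fix `R` under multiplication from the
left. The scalar is left free: it is automatically a sign when `R ≠ 0`. -/
def stabilizer (R : Matrix (ι → Fin 2) (ι → Fin 2) ℂ) : AddSubgroup (ι → ZMod 2 × ZMod 2) where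
  carrier := {p | ∃ ε : ℂ, pauliTensor p * R = ε • R}
  zero_mem' := ⟨1, by rw [pauliTensor_zero, one_mul, one_smul]⟩
  add_mem' := by
    rintro p q ⟨ε, hε⟩ ⟨δ, hδ⟩
    obtain ⟨c, hc, h⟩ := pauliTensor_mul p q
    refine ⟨c⁻¹ * (δ * ε), ?_⟩
    have h' : pauliTensor (p + q) = c⁻¹ • (pauliTensor p * pauliTensor q) := by
      rw [h, smul_smul, inv_mul_cancel₀ hc, one_smul]
    rw [h', smul_mul_assoc, mul_assoc, hδ, mul_smul_comm, hε, smul_smul, smul_smul,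
      mul_assoc]
  neg_mem' := by
    intro p hp
    rwa [neg_eq_of_add_eq_zero_left (add_self_eq_zero_label p)]

theorem mem_stabilizer {R : Matrix (ι → Fin 2) (ι → Fin 2) ℂ} {p : ι → ZMod 2 × ZMod 2} :
    p ∈ stabilizer R ↔ ∃ ε : ℂ, pauliTensor p * R = ε • R := Iff.rfl

theorem stabilizer_smul {c : ℂ} (hc : c ≠ 0) (R : Matrix (ι → Fin 2) (ι → Fin 2) ℂ) :
    stabilizer (c • R) = stabilizer R := by
  ext p
  refine exists_congr fun ε => ?_
  rw [mul_smul_comm, smul_comm ε c]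
  exact (smul_right_injective _ hc).eq_iff

theorem eigenvalue_mul_self {R : Matrix (ι → Fin 2) (ι → Fin 2) ℂ} (hR : R ≠ 0)
    {p : ι → ZMod 2 × ZMod 2} {ε : ℂ} (h : pauliTensor p * R = ε • R) : ε * ε = 1 := by
  have h2 : (ε * ε) • R = (1 : ℂ) • R := by
    rw [mul_smul, ← h, ← mul_smul_comm, ← h, ← mul_assoc, pauliTensor_mul_self, one_mul, one_smul]
  exact smul_left_injective ℂ hR h2

theorem trace_ne_zero_of_mem_stabilizer {R : Matrix (ι → Fin 2) (ι → Fin 2) ℂ}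
    (hR : R.trace ≠ 0) {p : ι → ZMod 2 × ZMod 2} (hp : p ∈ stabilizer R) :
    (pauliTensor p * R).trace ≠ 0 := by
  obtain ⟨ε, h⟩ := hp
  have hR0 : R ≠ 0 := by
    rintro rfl
    exact hR (Matrix.trace_zero _ _)
  have := eigenvalue_mul_self hR0 h
  rw [h, Matrix.trace_smul, smul_eq_mul]
  exact mul_ne_zero (left_ne_zero_of_mul_eq_one this) hR

theorem pauliSign_eq_one_of_mem_stabilizer {R : Matrix (ι → Fin 2) (ι → Fin 2) ℂ} (hR : R ≠ 0)
    {p q : ι → ZMod 2 × ZMod 2} (hp : p ∈ stabilizer R) (hq : q ∈ stabilizer R) :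
    pauliSign p q = 1 := by
  obtain ⟨ε, hε⟩ := hp
  obtain ⟨δ, hδ⟩ := hq
  rcases Int.units_eq_one_or (pauliSign p q) with h | h
  · exact h
  · have h1 := congrArg (· * R) (pauliTensor_mul_comm p q)
    simp only [h, smul_mul_assoc, mul_assoc, hε, hδ, mul_smul_comm, smul_smul] at h1
    have h2 := smul_left_injective ℂ hR h1
    have h3 := eigenvalue_mul_self hR hε
    have h4 := eigenvalue_mul_self hR hδ
    simp only [Units.val_neg, Units.val_one, Int.cast_neg, Int.cast_one] at h2
    -- `ε δ = - ε δ`, although both scalars square to `1`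
    have h5 : ε * δ = 0 := by linear_combination h2 / 2
    exfalso
    rcases mul_eq_zero.1 h5 with rfl | rfl <;> simp at h3 h4

/-- The defining property of (unnormalized) stabilizer states: every Pauli operator with nonzero
expectation value stabilizes the state up to a scalar. -/
def IsStabilizerState (R : Matrix (ι → Fin 2) (ι → Fin 2) ℂ) : Prop :=
  ∀ p, (pauliTensor p * R).trace ≠ 0 → p ∈ stabilizer R

theorem IsStabilizerState.smul {R : Matrix (ι → Fin 2) (ι → Fin 2) ℂ} (h : IsStabilizerState R)
    {c : ℂ} (hc : c ≠ 0) : IsStabilizerState (c • R) := by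
  intro p hp
  rw [stabilizer_smul hc]
  refine h p fun h0 => hp ?_
  rw [mul_smul_comm, Matrix.trace_smul, h0, smul_zero]

theorem isStabilizerState_one :
    IsStabilizerState (1 : Matrix (ι → Fin 2) (ι → Fin 2) ℂ) := by
  intro p hp
  have : p = 0 := by
    by_contra h
    exact hp (by rw [mul_one, trace_pauliTensor h])
  rw [this]
  exact zero_mem _

theorem eq_zero_of_mem_stabilizer_one {p : ι → ZMod 2 × ZMod 2}
    (hp : p ∈ stabilizer (1 : Matrix (ι → Fin 2) (ι → Fin 2) ℂ)) : p = 0 := by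
  by_contra h
  refine trace_ne_zero_of_mem_stabilizer ?_ hp (by rw [mul_one, trace_pauliTensor h])
  rw [Matrix.trace_one]
  exact Nat.cast_ne_zero.2 Fintype.card_ne_zero

/-- A stabilizer state is proportional to a projector, with the proportionality constant given by
the number of its stabilizers. -/
theorem IsStabilizerState.mul_self {R : Matrix (ι → Fin 2) (ι → Fin 2) ℂ}
    (h : IsStabilizerState R) (hR : R.trace = 1) :
    R * R = ((Nat.card (stabilizer R) / 2 ^ Fintype.card ι : ℝ) : ℂ) • R := by
  classical
  have hR0 : R ≠ 0 := by
    rintro rfl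
    simp at hR
  have h1 := congrArg (· * R) (sum_trace_smul_pauliTensor R)
  simp only [Finset.sum_mul, smul_mul_assoc] at h1
  have h2 : ∀ p, (pauliTensor p * R).trace • (pauliTensor p * R) =
      if p ∈ stabilizer R then R else 0 := by
    intro p
    split_ifs with hp
    · obtain ⟨ε, hε⟩ := hp
      rw [hε, Matrix.trace_smul, hR, smul_eq_mul, mul_one, smul_smul, eigenvalue_mul_self hR0 hε,
        one_smul]
    · rw [not_not.1 (mt (h p) hp), zero_smul]
  simp only [h2] at h1
  rw [← Finset.sum_filter, Finset.sum_const, ← Fintype.card_subtype, ← Nat.card_eq_fintype_card] at h1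
  have h3 : (2 : ℂ) ^ Fintype.card ι ≠ 0 := pow_ne_zero _ two_ne_zero
  have h4 : R * R = ((2 : ℂ) ^ Fintype.card ι)⁻¹ • ((2 : ℂ) ^ Fintype.card ι • (R * R)) := by
    rw [smul_smul, inv_mul_cancel₀ h3, one_smul]
  rw [h4, ← h1, ← Nat.cast_smul_eq_nsmul ℂ, smul_smul]
  congr 1
  push_cast
  rw [div_eq_inv_mul]

/-- The eigenvalues of `R` are `0` or `c`, so each of them contributes `-λ log c` to the entropy. -/
theorem entropy_eq_neg_log {κ : Type} [Fintype κ] [DecidableEq κ] {R : Matrix κ κ ℂ}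
    (hH : R.IsHermitian) (hR : R.trace = 1) {c : ℝ} (hc : R * R = (c : ℂ) • R) :
    entropy R hH = - Real.log c / Real.log 2 := by
  have hsum : ∑ i, hH.eigenvalues i = 1 := by
    have := hH.trace_eq_sum_eigenvalues
    rw [hR] at this
    exact Complex.ofReal_injective (by simpa using this.symm)
  have hev (i : κ) : hH.eigenvalues i * hH.eigenvalues i = c * hH.eigenvalues i := by
    have h1 := hH.mulVec_eigenvectorBasis i
    have h2 := congrArg (· *ᵥ (hH.eigenvectorBasis i).ofLp) hc
    simp only [← Matrix.mulVec_mulVec, h1, Matrix.mulVec_smul, Matrix.smul_mulVec] at h2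
    have h0 : (hH.eigenvectorBasis i).ofLp ≠ 0 := fun h =>
      hH.eigenvectorBasis.orthonormal.ne_zero i (by ext j; simp [h])
    obtain ⟨j, hj⟩ := Function.ne_iff.1 h0
    have h3 := congrFun h2 j
    simp only [Pi.smul_apply, Complex.real_smul, smul_eq_mul, ← mul_assoc] at h3
    exact_mod_cast mul_right_cancel₀ hj h3
  have hlog (i : κ) : Real.negMulLog (hH.eigenvalues i) = hH.eigenvalues i * -Real.log c := by
    by_cases h : hH.eigenvalues i = 0
    · simp [h]
    · rw [mul_right_cancel₀ h (hev i), Real.negMulLog]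
      ring
  rw [entropy, Finset.sum_congr rfl fun i _ => hlog i, ← Finset.sum_mul, hsum, one_mul]

/-- The entropy of a stabilizer state, in bits: the number of qubits minus the number of independent
stabilizers. -/
theorem IsStabilizerState.entropy_eq {R : Matrix (ι → Fin 2) (ι → Fin 2) ℂ}
    (h : IsStabilizerState R) (hH : R.IsHermitian) (hR : R.trace = 1) :
    entropy R hH = Fintype.card ι - Real.log (Nat.card (stabilizer R)) / Real.log 2 := by
  have h0 : (Nat.card (stabilizer R) : ℝ) ≠ 0 := Nat.cast_ne_zero.2 Nat.card_pos.ne'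
  have h2 : Real.log 2 ≠ 0 := (Real.log_pos one_lt_two).ne'
  rw [entropy_eq_neg_log hH hR (h.mul_self hR), Real.log_div h0 (by positivity), Real.log_pow]
  field_simp
  ring

end Stabilizer

/-! ### Pauli measurements of stabilizer states -/

section Measurement

variable {ι : Type} [Fintype ι]

/-- The operator `(1 + c P) / 2` for the Pauli operator `P` with label `p`. For `c = ± 1` it is the
projector onto an eigenspace of `P`. -/
def pauliProjector (p : ι → ZMod 2 × ZMod 2) (c : ℂ) : Matrix (ι → Fin 2) (ι → Fin 2) ℂ :=
  (1 / 2 : ℂ) • (1 + c • pauliTensor p)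

variable {p : ι → ZMod 2 × ZMod 2} {c : ℂ}

theorem pauliProjector_conjTranspose (hc : c * c = 1) :
    (pauliProjector p c)ᴴ = pauliProjector p c := by
  have h : star c = c := by
    rcases mul_self_eq_one_iff.1 hc with rfl | rfl <;> simp
  simp [pauliProjector, Matrix.conjTranspose_smul, pauliTensor_conjTranspose, h]

variable [DecidableEq ι]

theorem pauliTensor_mul_pauliProjector (hc : c * c = 1) :
    pauliTensor p * pauliProjector p c = c • pauliProjector p c := by
  simp only [pauliProjector, mul_smul_comm, mul_add, mul_one, pauliTensor_mul_self, smul_add,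
    smul_smul]
  rw [add_comm, show c * (1 / 2 * c) = 1 / 2 by linear_combination hc / 2, mul_comm c]

theorem pauliProjector_mul_pauliTensor (hc : c * c = 1) :
    pauliProjector p c * pauliTensor p = c • pauliProjector p c := by
  have h := congrArg Matrix.conjTranspose (pauliTensor_mul_pauliProjector (p := p) hc)
  have h' : star c = c := by
    rcases mul_self_eq_one_iff.1 hc with rfl | rfl <;> simp
  simpa [pauliProjector_conjTranspose hc, pauliTensor_conjTranspose, Matrix.conjTranspose_smul, h']
    using h

theorem pauliProjector_mul_self (hc : c * c = 1) :
    pauliProjector p c * pauliProjector p c = pauliProjector p c := by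
  have h : pauliProjector p c * pauliProjector p c =
      (1 / 2 : ℂ) • (pauliProjector p c + c • (pauliTensor p * pauliProjector p c)) := by
    conv_lhs => enter [1]; rw [pauliProjector]
    rw [smul_mul_assoc, add_mul, one_mul, smul_mul_assoc]
  rw [h, pauliTensor_mul_pauliProjector hc, smul_smul, hc, one_smul, ← two_smul ℂ, smul_smul]
  norm_num

theorem commute_pauliProjector {q : ι → ZMod 2 × ZMod 2} (h : pauliSign q p = 1) :
    pauliTensor q * pauliProjector p c = pauliProjector p c * pauliTensor q := by
  simp only [pauliProjector, mul_smul_comm, smul_mul_assoc, mul_add, add_mul, one_mul, mul_one]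
  rw [pauliTensor_mul_comm q p, h]
  simp

/-- A Pauli operator anticommuting with the measured one has zero expectation value after the
measurement. -/
theorem pauliSign_eq_one_of_trace_ne_zero (hc : c * c = 1)
    {R : Matrix (ι → Fin 2) (ι → Fin 2) ℂ} {q : ι → ZMod 2 × ZMod 2}
    (h : (pauliTensor q * (pauliProjector p c * R * pauliProjector p c)).trace ≠ 0) :
    pauliSign q p = 1 := by
  rcases Int.units_eq_one_or (pauliSign q p) with hs | hs
  · exact hs
  refine absurd ?_ h
  set R' := pauliProjector p c * R * pauliProjector p c with hR'
  have hl : pauliTensor p * R' = c • R' := by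
    rw [hR', mul_assoc, ← mul_assoc, pauliTensor_mul_pauliProjector hc, smul_mul_assoc]
  have hr : R' * pauliTensor p = c • R' := by
    rw [hR', mul_assoc, pauliProjector_mul_pauliTensor hc, mul_smul_comm]
  have h1 : (pauliTensor q * pauliTensor p * R').trace = c * (pauliTensor q * R').trace := by
    rw [mul_assoc, hl, mul_smul_comm, Matrix.trace_smul, smul_eq_mul]
  have h2 : (pauliTensor q * pauliTensor p * R').trace = -(c * (pauliTensor q * R').trace) := by
    rw [pauliTensor_mul_comm, hs]
    simp only [Units.val_neg, Units.val_one, Int.cast_neg, Int.cast_one, neg_smul, one_smul,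
      neg_mul, Matrix.trace_neg]
    rw [mul_assoc, Matrix.trace_mul_comm, mul_assoc, hr, mul_smul_comm, Matrix.trace_smul,
      smul_eq_mul]
  have h3 : c * (pauliTensor q * R').trace = 0 := by linear_combination (h2 - h1) / 2
  exact (mul_eq_zero.1 h3).resolve_left (left_ne_zero_of_mul_eq_one hc)

/-- The measured state has the expectation value `(⟨Q⟩ + c ⟨Q P⟩) / 2` of an operator `Q` commuting
with `P`, up to normalization, so one of the two summands is nonzero if it is. -/
theorem trace_measured (hc : c * c = 1) {R : Matrix (ι → Fin 2) (ι → Fin 2) ℂ}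
    {q : ι → ZMod 2 × ZMod 2} (hq : pauliSign q p = 1)
    (h : (pauliTensor q * (pauliProjector p c * R * pauliProjector p c)).trace ≠ 0) :
    (pauliTensor q * R).trace ≠ 0 ∨ (pauliTensor (q + p) * R).trace ≠ 0 := by
  by_contra! h0
  obtain ⟨d, -, hd⟩ := pauliTensor_mul q p
  refine h ?_
  have h1 : (pauliTensor q * (pauliProjector p c * R * pauliProjector p c)).trace =
      (pauliTensor q * pauliProjector p c * R).trace := by
    rw [← mul_assoc, Matrix.trace_mul_comm, ← mul_assoc, ← mul_assoc, ← commute_pauliProjector hq,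
      mul_assoc (pauliTensor q), pauliProjector_mul_self hc]
  rw [h1, pauliProjector, mul_smul_comm, mul_add, mul_one, mul_smul_comm, hd, smul_mul_assoc,
    add_mul, smul_mul_assoc, smul_mul_assoc, Matrix.trace_smul, Matrix.trace_add, Matrix.trace_smul,
    Matrix.trace_smul, h0.1, h0.2]
  simp

theorem measured_mem_stabilizer (hc : c * c = 1) (R : Matrix (ι → Fin 2) (ι → Fin 2) ℂ) :
    p ∈ stabilizer (pauliProjector p c * R * pauliProjector p c) :=
  ⟨c, by rw [mul_assoc, ← mul_assoc, pauliTensor_mul_pauliProjector hc, smul_mul_assoc]⟩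

theorem mem_stabilizer_measured {R : Matrix (ι → Fin 2) (ι → Fin 2) ℂ}
    {q : ι → ZMod 2 × ZMod 2} (hq : pauliSign q p = 1) (h : q ∈ stabilizer R) :
    q ∈ stabilizer (pauliProjector p c * R * pauliProjector p c) := by
  obtain ⟨ε, hε⟩ := h
  refine ⟨ε, ?_⟩
  rw [← mul_assoc, ← mul_assoc, commute_pauliProjector hq, mul_assoc _ _ R, hε, mul_smul_comm,
    smul_mul_assoc]

theorem mem_stabilizer_measured_of_add (hc : c * c = 1) {R : Matrix (ι → Fin 2) (ι → Fin 2) ℂ}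
    {q : ι → ZMod 2 × ZMod 2} (hq : pauliSign q p = 1) (h : q + p ∈ stabilizer R) :
    q ∈ stabilizer (pauliProjector p c * R * pauliProjector p c) := by
  have h1 : q + p ∈ stabilizer (pauliProjector p c * R * pauliProjector p c) :=
    mem_stabilizer_measured (by rw [pauliSign_add_left, hq, pauliSign_self, one_mul]) h
  have h2 := add_mem h1 (measured_mem_stabilizer hc R)
  rwa [add_assoc, add_self_eq_zero_label, add_zero] at h2

theorem IsStabilizerState.measured (hc : c * c = 1) {R : Matrix (ι → Fin 2) (ι → Fin 2) ℂ}
    (hR : IsStabilizerState R) :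
    IsStabilizerState (pauliProjector p c * R * pauliProjector p c) := by
  intro q hq
  have hs := pauliSign_eq_one_of_trace_ne_zero hc hq
  rcases trace_measured hc hs hq with h | h
  · exact mem_stabilizer_measured hs (hR _ h)
  · exact mem_stabilizer_measured_of_add hc hs (hR _ h)

open ComplexOrder in
theorem trace_mul_conjTranspose_eq_zero {κ : Type} [Fintype κ] {M : Matrix κ κ ℂ}
    (h : (M * Mᴴ).trace = 0) : M = 0 :=
  Matrix.trace_mul_conjTranspose_self_eq_zero_iff.1 h

/-- The Pauli operator with label `q` commutes with all stabilizers of `R`, i.e. `q` lies in the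
normalizer of the stabilizer group. -/
def CommutesWithStabilizer (R : Matrix (ι → Fin 2) (ι → Fin 2) ℂ) (q : ι → ZMod 2 × ZMod 2) :
    Prop :=
  ∀ s ∈ stabilizer R, pauliSign q s = 1

/-- The update rule for the normalizer under a measurement of `p`: it is generated by `p` and the
previous normalizer, restricted to the operators commuting with `p`. -/
theorem commutesWithStabilizer_measured (hc : c * c = 1)
    {R : Matrix (ι → Fin 2) (ι → Fin 2) ℂ} (hR : IsStabilizerState R)
    (htr : (pauliProjector p c * R * pauliProjector p c).trace ≠ 0)
    (q : ι → ZMod 2 × ZMod 2) :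
    CommutesWithStabilizer (pauliProjector p c * R * pauliProjector p c) q ↔
      pauliSign q p = 1 ∧ (CommutesWithStabilizer R q ∨ CommutesWithStabilizer R (q + p)) := by
  constructor
  · intro h
    refine ⟨h p (measured_mem_stabilizer hc R), ?_⟩
    by_contra! h0
    unfold CommutesWithStabilizer at h0
    push Not at h0
    obtain ⟨⟨s, hs, hqs⟩, t, ht, hqt⟩ := h0
    -- some stabilizer of `R` commutes with `p` but not with `q`: one of `s`, `t`, `s + t`
    have key : ∃ u ∈ stabilizer R, pauliSign u p = 1 ∧ pauliSign q u ≠ 1 := by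
      rw [pauliSign_add_left, pauliSign_comm p] at hqt
      rcases Int.units_eq_one_or (pauliSign s p) with h1 | h1
      · exact ⟨s, hs, h1, hqs⟩
      rcases Int.units_eq_one_or (pauliSign t p) with h2 | h2
      · exact ⟨t, ht, h2, by simpa [h2] using hqt⟩
      have h3 := (Int.units_eq_one_or (pauliSign q s)).resolve_left hqs
      refine ⟨s + t, add_mem hs ht, by simp [pauliSign_add_left, h1, h2], ?_⟩
      rcases Int.units_eq_one_or (pauliSign q t) with h4 | h4
      · simp [pauliSign_add_right, h3, h4]
      · simp [h2, h4] at hqt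
    obtain ⟨u, hu, hup, hqu⟩ := key
    exact hqu (h u (mem_stabilizer_measured hup hu))
  · rintro ⟨hqp, h⟩ u hu
    have htu := trace_ne_zero_of_mem_stabilizer htr hu
    have hup := pauliSign_eq_one_of_trace_ne_zero hc htu
    have key : u ∈ stabilizer R ∨ u + p ∈ stabilizer R :=
      (trace_measured hc hup htu).imp (hR _) (hR _)
    rcases h with h | h <;> rcases key with hu | hu
    · exact h u hu
    · have := h _ hu
      rwa [pauliSign_add_right, hqp, mul_one] at this
    · have := h _ hu
      rwa [pauliSign_add_left, pauliSign_comm p, hup, mul_one] at this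
    · have := h _ hu
      rwa [pauliSign_add_left, pauliSign_add_right, pauliSign_add_right, hqp, pauliSign_comm p, hup,
        pauliSign_self, mul_one, mul_one, mul_one] at this

/-- The product `Π_τ ⋯ Π_1` of Pauli projectors, latest leftmost. -/
def projectorProduct {τ : ℕ} (p : Fin τ → ι → ZMod 2 × ZMod 2) (c : Fin τ → ℂ) :
    Matrix (ι → Fin 2) (ι → Fin 2) ℂ :=
  (List.ofFn fun j => pauliProjector (p j) (c j)).reverse.prod

theorem projectorProduct_succ {τ : ℕ} (p : Fin (τ + 1) → ι → ZMod 2 × ZMod 2)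
    (c : Fin (τ + 1) → ℂ) :
    projectorProduct p c = pauliProjector (p (Fin.last τ)) (c (Fin.last τ)) *
      projectorProduct (fun j => p j.castSucc) (fun j => c j.castSucc) := by
  rw [projectorProduct, List.ofFn_succ', List.concat_eq_append, List.reverse_append,
    List.reverse_singleton, List.singleton_append, List.prod_cons, projectorProduct]

theorem projectorProduct_mul_conjTranspose_succ {τ : ℕ} (p : Fin (τ + 1) → ι → ZMod 2 × ZMod 2)
    {c : Fin (τ + 1) → ℂ} (hc : ∀ j, c j * c j = 1) :
    projectorProduct p c * (projectorProduct p c)ᴴ =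
      pauliProjector (p (Fin.last τ)) (c (Fin.last τ)) *
        (projectorProduct (fun j => p j.castSucc) (fun j => c j.castSucc) *
          (projectorProduct (fun j => p j.castSucc) (fun j => c j.castSucc))ᴴ) *
        pauliProjector (p (Fin.last τ)) (c (Fin.last τ)) := by
  rw [projectorProduct_succ, Matrix.conjTranspose_mul, pauliProjector_conjTranspose (hc _)]
  simp only [mul_assoc]

theorem isStabilizerState_projectorProduct {τ : ℕ} (p : Fin τ → ι → ZMod 2 × ZMod 2)
    {c : Fin τ → ℂ} (hc : ∀ j, c j * c j = 1) :
    IsStabilizerState (projectorProduct p c * (projectorProduct p c)ᴴ) := by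
  induction τ with
  | zero => simpa [projectorProduct] using isStabilizerState_one
  | succ τ ih =>
    rw [projectorProduct_mul_conjTranspose_succ p hc]
    exact (ih _ fun j => hc _).measured (hc _)

/-- The Pauli operators commuting with all stabilizers of the state after the measurements of
`p 0, …, p (τ - 1)` are those whose codeword is a product of error vectors: unfolding the update
rule of the normalizer, `q` times a product of some of the `p i` has to commute with `p j`, where
only factors with `i ≥ j` are involved. -/
theorem commutesWithStabilizer_projectorProduct {τ : ℕ} (p : Fin τ → ι → ZMod 2 × ZMod 2)
    {c : Fin τ → ℂ} (hc : ∀ j, c j * c j = 1) (h0 : projectorProduct p c ≠ 0)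
    (q : ι → ZMod 2 × ZMod 2) :
    CommutesWithStabilizer (projectorProduct p c * (projectorProduct p c)ᴴ) q ↔
      ∃ a : Fin τ → ℤ, ∀ j,
        ∏ i, (if j ≤ i then pauliSign (p i) (p j) else 1) ^ a i = pauliSign q (p j) := by
  induction τ generalizing q with
  | zero =>
    refine iff_of_true (fun s hs => ?_) ⟨finZeroElim, finZeroElim⟩
    have hs' : s = 0 := eq_zero_of_mem_stabilizer_one (by simpa [projectorProduct] using hs)
    have h := pauliSign_add_right q s s
    rw [add_self_eq_zero_label, Int.units_mul_self] at h
    rw [hs', h]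
  | succ τ ih =>
    have h0' : projectorProduct (fun j : Fin τ => p j.castSucc) (fun j => c j.castSucc) ≠ 0 := by
      intro h
      rw [projectorProduct_succ, h, mul_zero] at h0
      exact h0 rfl
    have htr := mt trace_mul_conjTranspose_eq_zero h0
    have ih' := ih (fun j => p j.castSucc) (fun j => hc _) h0'
    rw [projectorProduct_mul_conjTranspose_succ p hc] at htr ⊢
    rw [commutesWithStabilizer_measured (hc _)
      (isStabilizerState_projectorProduct (fun j => p j.castSucc) fun j => hc _) htr, ih', ih']
    simp only [Fin.prod_univ_castSucc, Fin.castSucc_le_castSucc_iff, Fin.forall_fin_succ',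
      pauliSign_self, Fin.le_last, if_true, pauliSign_add_left]
    have hlast : ∀ i : Fin τ, ¬ Fin.last τ ≤ i.castSucc := fun i => not_le.2 (Fin.castSucc_lt_last i)
    simp only [hlast, if_false, one_zpow, Finset.prod_const_one, mul_one]
    constructor
    · rintro ⟨hq, ⟨a, ha⟩ | ⟨a, ha⟩⟩
      · exact ⟨Fin.snoc a 0, fun j => by simpa using ha j, hq.symm⟩
      · refine ⟨Fin.snoc a 1, fun j => ?_, hq.symm⟩
        simp only [Fin.snoc_castSucc, Fin.snoc_last, zpow_one, ha, mul_assoc, Int.units_mul_self,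
          mul_one]
    · rintro ⟨a, ha, hq⟩
      refine ⟨hq.symm, ?_⟩
      rcases Int.even_or_odd (a (Fin.last τ)) with h | h
      · refine Or.inl ⟨fun j => a j.castSucc, fun j => ?_⟩
        have h1 : pauliSign (p (Fin.last τ)) (p j.castSucc) ^ a (Fin.last τ) = 1 := by
          rcases Int.units_eq_one_or (pauliSign (p (Fin.last τ)) (p j.castSucc)) with h2 | h2
          · rw [h2, one_zpow]
          · rw [h2, h.neg_one_zpow]
        rw [← ha j, h1, mul_one]
      · refine Or.inr ⟨fun j => a j.castSucc, fun j => ?_⟩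
        have h1 : pauliSign (p (Fin.last τ)) (p j.castSucc) ^ a (Fin.last τ) =
            pauliSign (p (Fin.last τ)) (p j.castSucc) := by
          rcases Int.units_eq_one_or (pauliSign (p (Fin.last τ)) (p j.castSucc)) with h2 | h2
          · rw [h2, one_zpow]
          · rw [h2, h.neg_one_zpow]
        rw [← ha j, h1, mul_assoc, Int.units_mul_self, mul_one]

end Measurement
/-! ### Subsystems and mutual information -/

section Subsystem

variable {n : ℕ}

/-- Extension of a label on the qubits of `S` by the identity on all other qubits. -/
def extendLabel (S : Finset (Fin n)) (a : S → ZMod 2 × ZMod 2) : PauliString n :=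
  fun i => if h : i ∈ S then a ⟨i, h⟩ else 0

theorem extendLabel_add (S : Finset (Fin n)) (a b : S → ZMod 2 × ZMod 2) :
    extendLabel S (a + b) = extendLabel S a + extendLabel S b := by
  funext i
  by_cases h : i ∈ S <;> simp [extendLabel, h]

theorem extendLabel_injective (S : Finset (Fin n)) : Function.Injective (extendLabel S) := by
  intro a b h
  funext i
  simpa [extendLabel] using congrFun h i

theorem extendLabel_zero (S : Finset (Fin n)) : extendLabel S 0 = 0 := by
  funext i
  simp [extendLabel]

theorem supportedOn_extendLabel (S : Finset (Fin n)) (a : S → ZMod 2 × ZMod 2) :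
    SupportedOn S (extendLabel S a) := fun i hi => by simp [extendLabel, hi]

theorem extendLabel_restrict {S : Finset (Fin n)} {p : PauliString n} (hp : SupportedOn S p) :
    extendLabel S (fun i => p i) = p := by
  funext i
  by_cases h : i ∈ S
  · simp [extendLabel, h]
  · simp [extendLabel, h, hp i h]

theorem pauliSign_extendLabel (S : Finset (Fin n)) (a : S → ZMod 2 × ZMod 2) (s : PauliString n) :
    pauliSign (extendLabel S a) s = pauliSign a (fun i => s i) := by
  have h0 : ∀ b, qubitSign 0 b = 1 := by decide
  rw [pauliSign, ← Finset.prod_subset S.subset_univ fun i _ hi => by simp [extendLabel, hi, h0],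
    ← Finset.prod_coe_sort]
  exact Finset.prod_congr rfl fun i _ => by simp [extendLabel]

/-- Basis labels of all qubits are pairs of basis labels of `S` and of its complement. -/
def glueEquiv (S : Finset (Fin n)) :
    (S → Fin 2) × ((Sᶜ : Finset (Fin n)) → Fin 2) ≃ (Fin n → Fin 2) where
  toFun x := glue S x.1 x.2
  invFun f := (fun i => f i, fun i => f i)
  left_inv x := by
    ext i
    · simp [glue]
    · simp [glue, Finset.mem_compl.1 i.2]
  right_inv f := by
    ext i
    by_cases h : i ∈ S <;> simp [glue, h]

theorem sum_glue (S : Finset (Fin n)) (f : (Fin n → Fin 2) → ℂ) :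
    ∑ x, ∑ z, f (glue S x z) = ∑ k, f k := by
  rw [← (glueEquiv S).sum_comp, Fintype.sum_prod_type]
  rfl

theorem pauliTensor_extendLabel_glue (S : Finset (Fin n)) (a : S → ZMod 2 × ZMod 2)
    (x y : S → Fin 2) (z w : (Sᶜ : Finset (Fin n)) → Fin 2) :
    pauliTensor (extendLabel S a) (glue S x z) (glue S y w) =
      if z = w then pauliTensor a x y else 0 := by
  simp only [pauliTensor, Matrix.of_apply]
  rw [← Finset.prod_mul_prod_compl S, ← Finset.prod_coe_sort S, ← Finset.prod_coe_sort Sᶜ]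
  have h1 : ∏ i : S, pauliMatrix (extendLabel S a i) (glue S x z i) (glue S y w i) =
      ∏ i, pauliMatrix (a i) (x i) (y i) :=
    Finset.prod_congr rfl fun i _ => by simp [extendLabel, glue]
  have h2 : ∏ i : (Sᶜ : Finset (Fin n)),
      pauliMatrix (extendLabel S a i) (glue S x z i) (glue S y w i) = if z = w then 1 else 0 := by
    have h (i : (Sᶜ : Finset (Fin n))) :
        pauliMatrix (extendLabel S a i) (glue S x z i) (glue S y w i) =
          if z i = w i then 1 else 0 := by
      have hm : pauliMatrix 0 = 1 := pauliMatrix_zero_zero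
      simp [extendLabel, glue, Finset.mem_compl.1 i.2, hm, Matrix.one_apply]
    rw [Finset.prod_congr rfl fun i _ => h i, Finset.prod_ite_zero]
    simp [funext_iff]
  rw [h1, h2]
  simp

theorem trace_reduced (S : Finset (Fin n)) (ρ : Operator n) : (reduced S ρ).trace = ρ.trace := by
  simp only [Matrix.trace, Matrix.diag_apply, reduced, Matrix.of_apply]
  exact sum_glue S fun k => ρ k k

theorem reduced_smul (S : Finset (Fin n)) (c : ℂ) (ρ : Operator n) :
    reduced S (c • ρ) = c • reduced S ρ := by
  ext x y
  simp [reduced, Finset.mul_sum]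

theorem reduced_pauliTensor_mul (S : Finset (Fin n)) (a : S → ZMod 2 × ZMod 2) (ρ : Operator n) :
    reduced S (pauliTensor (extendLabel S a) * ρ) = pauliTensor a * reduced S ρ := by
  ext x y
  simp only [reduced, Matrix.of_apply, Matrix.mul_apply, ← sum_glue S,
    pauliTensor_extendLabel_glue, ite_mul, zero_mul, Finset.sum_ite_eq, Finset.mem_univ, if_true,
    Finset.mul_sum]
  exact Finset.sum_comm

/-- The stabilizers of a reduced state are the stabilizers of the state supported on the
subsystem. -/
theorem mem_stabilizer_reduced {ρ : Operator n} (h : IsStabilizerState ρ) (hρ : ρ.trace ≠ 0)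
    (S : Finset (Fin n)) (a : S → ZMod 2 × ZMod 2) :
    a ∈ stabilizer (reduced S ρ) ↔ extendLabel S a ∈ stabilizer ρ := by
  constructor
  · intro ha
    refine h _ ?_
    rw [← trace_reduced S, reduced_pauliTensor_mul]
    exact trace_ne_zero_of_mem_stabilizer (by rwa [trace_reduced]) ha
  · rintro ⟨ε, hε⟩
    exact ⟨ε, by rw [← reduced_pauliTensor_mul, hε, reduced_smul]⟩

theorem IsStabilizerState.reduced {ρ : Operator n} (h : IsStabilizerState ρ) (hρ : ρ.trace ≠ 0)
    (S : Finset (Fin n)) : IsStabilizerState (reduced S ρ) := by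
  intro a ha
  rw [mem_stabilizer_reduced h hρ]
  refine h _ ?_
  rwa [← trace_reduced S, reduced_pauliTensor_mul]

theorem sum_sign_character {G : Type} [AddGroup G] [Fintype G] (χ : G → ℤˣ)
    (hχ : ∀ g h, χ (g + h) = χ g * χ h) [Decidable (∀ g, χ g = 1)] :
    ∑ g, (χ g : ℤ) = if ∀ g, χ g = 1 then (Fintype.card G : ℤ) else 0 := by
  split_ifs with h
  · simp [h]
  · push Not at h
    obtain ⟨g, hg⟩ := h
    have h1 : ∑ x, (χ (g + x) : ℤ) = ∑ x, (χ x : ℤ) :=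
      Equiv.sum_comp (Equiv.addLeft g) fun x => (χ x : ℤ)
    simp only [hχ, (Int.units_eq_one_or (χ g)).resolve_left hg, neg_mul, one_mul, Units.val_neg,
      Finset.sum_neg_distrib] at h1
    omega

/-- Double counting of `∑ pauliSign a s` over the labels `a` on `A` and `s ∈ H`, by orthogonality
of characters in either variable. -/
theorem card_mul_card_centralizer (H : AddSubgroup (PauliString n)) (A : Finset (Fin n)) :
    Nat.card H * Nat.card {a : A → ZMod 2 × ZMod 2 // ∀ s ∈ H, pauliSign (extendLabel A a) s = 1} =
      4 ^ A.card *
        Nat.card {b : (Aᶜ : Finset (Fin n)) → ZMod 2 × ZMod 2 // extendLabel Aᶜ b ∈ H} := by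
  classical
  have h1 (a : A → ZMod 2 × ZMod 2) : ∑ s : H, (pauliSign (extendLabel A a) (s : PauliString n) : ℤ)
      = if ∀ s ∈ H, pauliSign (extendLabel A a) s = 1 then (Fintype.card H : ℤ) else 0 := by
    rw [sum_sign_character (fun s : H => pauliSign (extendLabel A a) (s : PauliString n))
      fun g h => by rw [AddSubgroup.coe_add, pauliSign_add_right]]
    simp only [Subtype.forall]
  have h2 (s : PauliString n) : ∑ a, (pauliSign (extendLabel A a) s : ℤ) =
      if SupportedOn Aᶜ s then (4 : ℤ) ^ A.card else 0 := by
    rw [sum_sign_character (fun a => pauliSign (extendLabel A a) s)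
      fun g h => by rw [extendLabel_add, pauliSign_add_left]]
    have hiff : (∀ a, pauliSign (extendLabel A a) s = 1) ↔ SupportedOn Aᶜ s := by
      constructor
      · intro h i hi
        have hi' : i ∈ A := by simpa using hi
        refine eq_zero_of_qubitSign _ fun b => ?_
        have hb := h (Pi.single ⟨i, hi'⟩ b)
        have h0 : ∀ b, qubitSign 0 b = 1 := by decide
        rw [pauliSign_extendLabel, pauliSign, Finset.prod_eq_single ⟨i, hi'⟩] at hb
        · simpa using hb
        · intro j _ hj
          rw [Pi.single_eq_of_ne hj, h0]
        · simp
      · intro h a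
        have h0 : ∀ b, qubitSign b 0 = 1 := by decide
        rw [pauliSign_extendLabel, pauliSign]
        exact Finset.prod_eq_one fun i _ => by rw [h i (by simp), h0]
    simp only [hiff]
    congr 1
    simp
  have h3 : Nat.card {b : (Aᶜ : Finset (Fin n)) → ZMod 2 × ZMod 2 // extendLabel Aᶜ b ∈ H} =
      Nat.card {s : H // SupportedOn Aᶜ (s : PauliString n)} := by
    refine Nat.card_congr
      { toFun := fun b => ⟨⟨_, b.2⟩, supportedOn_extendLabel _ _⟩
        invFun := fun s => ⟨fun i => s.1.1 i, by rw [extendLabel_restrict s.2]; exact s.1.2⟩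
        left_inv := fun b => Subtype.ext (extendLabel_injective _ ?_)
        right_inv := fun s => Subtype.ext (Subtype.ext (extendLabel_restrict s.2)) }
    exact extendLabel_restrict (supportedOn_extendLabel _ _)
  have h4 := Finset.sum_comm (s := Finset.univ) (t := Finset.univ)
    (f := fun (a : A → ZMod 2 × ZMod 2) (s : H) =>
      (pauliSign (extendLabel A a) (s : PauliString n) : ℤ))
  simp only [h1, h2] at h4
  rw [← Finset.sum_filter, ← Finset.sum_filter, Finset.sum_const, Finset.sum_const,
    ← Fintype.card_subtype, ← Fintype.card_subtype, nsmul_eq_mul, nsmul_eq_mul] at h4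
  rw [h3, Nat.card_eq_fintype_card, Nat.card_eq_fintype_card, Nat.card_eq_fintype_card, mul_comm,
    mul_comm (4 ^ A.card)]
  exact_mod_cast h4

/-- A stabilizer state has maximal mutual information between `A` and its complement iff no
nontrivial Pauli operator on `A` commutes with all stabilizers. -/
theorem mutualInformation_eq_iff {ρ : Operator n} (h : IsStabilizerState ρ) (hρ : ρ.trace = 1)
    (hH : ρ.IsHermitian) (A : Finset (Fin n)) :
    mutualInformation A ρ hH = 2 * (A.card : ℝ) ↔
      ∀ p, SupportedOn A p → p ≠ 0 → ¬ CommutesWithStabilizer ρ p := by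
  have hρ1 : ρ.trace ≠ 0 := by simp [hρ]
  have hρ0 : ρ ≠ 0 := by
    rintro rfl
    simp at hρ
  set N := {a : A → ZMod 2 × ZMod 2 // ∀ s ∈ stabilizer ρ, pauliSign (extendLabel A a) s = 1}
  have zero_comm : ∀ s ∈ stabilizer ρ, pauliSign (extendLabel A 0) s = 1 := fun s _ => by
    have h0 := pauliSign_self s
    rw [← add_zero s, pauliSign_add_left, add_zero, pauliSign_self, one_mul] at h0
    rw [extendLabel_zero, h0]
  have : Nonempty N := ⟨⟨0, zero_comm⟩⟩
  have hSpos : 0 < Nat.card (stabilizer ρ) := Nat.card_pos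
  have hApos : 0 < Nat.card (stabilizer (reduced A ρ)) := Nat.card_pos
  have hBpos : 0 < Nat.card (stabilizer (reduced Aᶜ ρ)) := Nat.card_pos
  -- stabilizers commute, so those supported on `A` are counted by `N` as well
  have hle : Nat.card (stabilizer (reduced A ρ)) ≤ Nat.card N := by
    refine Nat.card_le_card_of_injective (fun a => ⟨a.1, fun s hs => ?_⟩) fun a b hab => ?_
    · exact pauliSign_eq_one_of_mem_stabilizer hρ0 ((mem_stabilizer_reduced h hρ1 A a.1).1 a.2) hs
    · exact Subtype.ext (Subtype.mk.inj hab)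
  have hcount : Nat.card (stabilizer ρ) * Nat.card N =
      4 ^ A.card * Nat.card (stabilizer (reduced Aᶜ ρ)) := by
    rw [card_mul_card_centralizer]
    congr 1
    exact Nat.card_congr (Equiv.subtypeEquivRight fun b => (mem_stabilizer_reduced h hρ1 _ b).symm)
  have hentropy : mutualInformation A ρ hH = 2 * (A.card : ℝ) ↔
      Nat.card (stabilizer ρ) = 4 ^ A.card *
        (Nat.card (stabilizer (reduced A ρ)) * Nat.card (stabilizer (reduced Aᶜ ρ))) := by
    rw [mutualInformation, (h.reduced hρ1 A).entropy_eq _ (by rw [trace_reduced, hρ]),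
      (h.reduced hρ1 Aᶜ).entropy_eq _ (by rw [trace_reduced, hρ]), h.entropy_eq _ hρ]
    have hcard : (n : ℝ) = A.card + (Aᶜ : Finset (Fin n)).card := by
      exact_mod_cast ((Finset.card_add_card_compl A).trans (Fintype.card_fin n)).symm
    have h2 : Real.log 2 ≠ 0 := (Real.log_pos one_lt_two).ne'
    have h4 : Real.log 4 = 2 * Real.log 2 := by
      rw [show (4 : ℝ) = 2 ^ 2 by norm_num, Real.log_pow]
      norm_num
    have hS' : (0 : ℝ) < Nat.card (stabilizer ρ) := Nat.cast_pos.2 hSpos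
    have hA' : (0 : ℝ) < Nat.card (stabilizer (reduced A ρ)) := Nat.cast_pos.2 hApos
    have hB' : (0 : ℝ) < Nat.card (stabilizer (reduced Aᶜ ρ)) := Nat.cast_pos.2 hBpos
    rw [Fintype.card_coe, Fintype.card_coe, Fintype.card_fin, hcard, ← Nat.cast_inj (R := ℝ)]
    push_cast
    rw [← Real.log_injOn_pos.eq_iff hS' (Set.mem_Ioi.2 (by positivity)),
      Real.log_mul (by positivity) (by positivity), Real.log_mul hA'.ne' hB'.ne', Real.log_pow, h4]
    field_simp
    constructor <;> intro h <;> linarith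
  have hone : mutualInformation A ρ hH = 2 * (A.card : ℝ) ↔ Nat.card N = 1 := by
    rw [hentropy, mul_left_comm, ← hcount]
    constructor
    · intro h1
      have h2 : Nat.card (stabilizer (reduced A ρ)) * Nat.card N = 1 :=
        Nat.eq_of_mul_eq_mul_left hSpos (by linarith)
      exact Nat.eq_one_of_mul_eq_one_left h2
    · intro h1
      rw [h1] at hle ⊢
      rw [show Nat.card (stabilizer (reduced A ρ)) = 1 by omega]
      simp
  rw [hone, Nat.card_eq_one_iff_unique, and_iff_left ‹_›]
  constructor
  · rintro h1 p hp hp0 hcomm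
    have h2 := Subtype.mk.inj (h1.elim ⟨fun i => p i, fun s hs => by
      rw [extendLabel_restrict hp]; exact hcomm s hs⟩ ⟨0, zero_comm⟩)
    exact hp0 (by rw [← extendLabel_restrict hp, h2, extendLabel_zero])
  · intro h1
    have h2 (a : N) : a = ⟨0, zero_comm⟩ := by
      by_contra h0
      refine h1 (extendLabel A a.1) (supportedOn_extendLabel A _) (fun h3 => h0 ?_) a.2
      exact Subtype.ext (extendLabel_injective A (h3.trans (extendLabel_zero A).symm))
    exact ⟨fun a b => (h2 a).trans (h2 b).symm⟩

end Subsystem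

/-! ### Monitored circuits and the dual code -/

section Circuit

variable {n τ : ℕ}

theorem IsClifford.one : IsClifford (1 : Operator n) :=
  ⟨one_mem _, fun p => ⟨0, p, by simp⟩⟩

theorem IsClifford.mul {U V : Operator n} (hU : IsClifford U) (hV : IsClifford V) :
    IsClifford (U * V) := by
  refine ⟨mul_mem hU.1 hV.1, fun p => ?_⟩
  obtain ⟨k, q, hq⟩ := hV.2 p
  obtain ⟨l, s, hs⟩ := hU.2 q
  refine ⟨k + l, s, ?_⟩
  have h : U * V * pauliOp p * (U * V)ᴴ = U * (V * pauliOp p * Vᴴ) * Uᴴ := by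
    simp only [Matrix.conjTranspose_mul, mul_assoc]
  rw [h, hq, mul_smul_comm, smul_mul_assoc, hs, smul_smul, pow_add]

theorem isClifford_list_prod {l : List (Operator n)} (h : ∀ U ∈ l, IsClifford U) :
    IsClifford l.prod := by
  induction l with
  | nil => exact IsClifford.one
  | cons U l ih =>
    rw [List.prod_cons]
    exact (h U (by simp)).mul (ih fun V hV => h V (by simp [hV]))

theorem conjTranspose_mul_self_of_mem {U : Operator n}
    (h : U ∈ Matrix.unitaryGroup (Fin n → Fin 2) ℂ) : Uᴴ * U = 1 :=
  Matrix.mem_unitaryGroup_iff'.1 h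

theorem mul_conjTranspose_self_of_mem {U : Operator n}
    (h : U ∈ Matrix.unitaryGroup (Fin n → Fin 2) ℂ) : U * Uᴴ = 1 :=
  Matrix.mem_unitaryGroup_iff.1 h

/-- Moving all unitaries to the right, past the operators which they conjugate: with `L j` the
product `U_τ ⋯ U_j`, the product of the `U_j M_j` is that of the `L_j M_j L_jᴴ` times `L_1`. -/
theorem prod_reverse_ofFn_mul (U M : Fin τ → Operator n)
    (hU : ∀ j, U j ∈ Matrix.unitaryGroup (Fin n → Fin 2) ℂ) :
    (List.ofFn fun j => U j * M j).reverse.prod =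
      (List.ofFn fun j : Fin τ => ((List.ofFn U).drop j).reverse.prod * M j *
        (((List.ofFn U).drop j).reverse.prod)ᴴ).reverse.prod * (List.ofFn U).reverse.prod := by
  induction τ with
  | zero => simp
  | succ τ ih =>
    have ih' := ih (fun j => U j.succ) (fun j => M j.succ) fun j => hU _
    have hV : (List.ofFn U).reverse.prod ∈ Matrix.unitaryGroup (Fin n → Fin 2) ℂ := by
      refine Submonoid.list_prod_mem _ fun V hV => ?_
      obtain ⟨j, rfl⟩ := (List.mem_ofFn' _ _).1 (List.mem_reverse.1 hV)
      exact hU j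
    have hV' := conjTranspose_mul_self_of_mem hV
    rw [List.ofFn_succ, List.ofFn_succ (f := fun j : Fin (τ + 1) => _ * M j * _)]
    simp only [List.reverse_cons, List.prod_append, List.prod_singleton, Fin.val_zero,
      List.drop_zero]
    rw [ih', mul_assoc _ _ (List.ofFn U).reverse.prod, mul_assoc (_ * M 0), hV', mul_one]
    simp only [List.ofFn_succ, List.reverse_cons, List.prod_append, List.prod_singleton,
      Fin.val_succ, List.drop_succ_cons, mul_assoc]

namespace Circuit

variable (𝒞 : Circuit n τ)

theorem isClifford_laterGates (j : Fin τ) : IsClifford (𝒞.laterGates j) := by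
  refine isClifford_list_prod fun U hU => ?_
  obtain ⟨i, rfl⟩ := (List.mem_ofFn' _ _).1 (List.mem_of_mem_drop (List.mem_reverse.1 hU))
  exact 𝒞.gate_clifford i

theorem exists_evolved_eq (j : Fin τ) :
    ∃ (p : PauliString n) (c : ℂ), c * c = 1 ∧ 𝒞.evolved j = c • pauliTensor p := by
  have hL := 𝒞.isClifford_laterGates j
  obtain ⟨k, p, hp⟩ := hL.2 (𝒞.meas j)
  refine ⟨p, Complex.I ^ k, ?_, hp⟩
  have h1 : 𝒞.evolved j * 𝒞.evolved j = 1 := by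
    have hm : pauliOp (𝒞.meas j) * pauliOp (𝒞.meas j) = 1 := pauliTensor_mul_self _
    rw [evolved]
    calc _ = 𝒞.laterGates j * (pauliOp (𝒞.meas j) * ((𝒞.laterGates j)ᴴ * 𝒞.laterGates j) *
          pauliOp (𝒞.meas j)) * (𝒞.laterGates j)ᴴ := by simp only [mul_assoc]
      _ = 1 := by
        rw [conjTranspose_mul_self_of_mem hL.1, mul_one, hm, mul_one,
          mul_conjTranspose_self_of_mem hL.1]
  have h2 : 𝒞.evolved j = (Complex.I ^ k) • pauliTensor p := hp
  rw [h2, smul_mul_assoc, mul_smul_comm, pauliTensor_mul_self, smul_smul] at h1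
  exact smul_left_injective ℂ (one_ne_zero (α := Operator n)) (h1.trans (one_smul ℂ _).symm)

/-- The label of the time-evolved measured Pauli operator at step `j`. -/
def evolvedLabel (j : Fin τ) : PauliString n := (𝒞.exists_evolved_eq j).choose

/-- The phase, in fact a sign, of the time-evolved measured Pauli operator at step `j`. -/
def evolvedPhase (j : Fin τ) : ℂ := (𝒞.exists_evolved_eq j).choose_spec.choose

theorem evolvedPhase_mul_self (j : Fin τ) : 𝒞.evolvedPhase j * 𝒞.evolvedPhase j = 1 :=
  (𝒞.exists_evolved_eq j).choose_spec.choose_spec.1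

theorem evolved_eq (j : Fin τ) :
    𝒞.evolved j = 𝒞.evolvedPhase j • pauliTensor (𝒞.evolvedLabel j) :=
  (𝒞.exists_evolved_eq j).choose_spec.choose_spec.2

theorem commSign_smul {c d : ℂ} (hc : c ≠ 0) (hd : d ≠ 0) (p q : PauliString n) :
    commSign (c • pauliTensor p) (d • pauliTensor q) = pauliSign p q := by
  have hne : pauliTensor q * pauliTensor p ≠ 0 := by
    obtain ⟨e, he, h⟩ := pauliTensor_mul q p
    rw [h]
    exact smul_ne_zero he (pauliTensor_ne_zero _)
  have hiff : (c • pauliTensor p) * (d • pauliTensor q) = (d • pauliTensor q) * (c • pauliTensor p)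
      ↔ pauliSign p q = 1 := by
    simp only [smul_mul_assoc, mul_smul_comm, smul_comm d c]
    rw [(smul_right_injective _ hc).eq_iff, (smul_right_injective _ hd).eq_iff,
      pauliTensor_mul_comm p q]
    constructor
    · intro h
      have h1 := smul_left_injective ℂ hne (h.trans (one_smul ℂ _).symm)
      exact Units.ext (Int.cast_injective (α := ℂ) (by simpa using h1))
    · intro h
      simp [h]
  unfold commSign
  split_ifs with h
  · exact (hiff.1 h).symm
  · exact ((Int.units_eq_one_or _).resolve_left (mt hiff.2 h)).symm

theorem evolvedPhase_ne_zero (j : Fin τ) : 𝒞.evolvedPhase j ≠ 0 :=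
  left_ne_zero_of_mul_eq_one (𝒞.evolvedPhase_mul_self j)

theorem codeword_apply (p : PauliString n) (j : Fin τ) :
    𝒞.codeword p j = pauliSign p (𝒞.evolvedLabel j) := by
  have h := commSign_smul one_ne_zero (𝒞.evolvedPhase_ne_zero j) p (𝒞.evolvedLabel j)
  rw [one_smul, ← evolved_eq] at h
  exact h

theorem codeword_add (p q : PauliString n) :
    𝒞.codeword (p + q) = 𝒞.codeword p * 𝒞.codeword q := by
  funext j
  simp only [Pi.mul_apply, codeword_apply, pauliSign_add_left]

theorem mem_errorSet {v : Fin τ → ℤˣ} : v ∈ 𝒞.errorSet ↔ ∃ a : Fin τ → ℤ, ∀ j,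
    ∏ i, (if j ≤ i then pauliSign (𝒞.evolvedLabel i) (𝒞.evolvedLabel j) else 1) ^ a i = v j := by
  rw [errorSet, Subgroup.mem_closure_range_iff_of_fintype]
  refine exists_congr fun a => ?_
  rw [funext_iff]
  refine forall_congr' fun j => ?_
  simp only [Finset.prod_apply, Pi.pow_apply, errorVector, evolved_eq,
    commSign_smul (𝒞.evolvedPhase_ne_zero _) (𝒞.evolvedPhase_ne_zero _)]
  exact eq_comm

theorem fullyRecoverable_iff (A : Finset (Fin n)) : 𝒞.FullyRecoverable A ↔
    ∀ p : PauliString n, SupportedOn A p → p ≠ 0 → 𝒞.codeword p ∉ 𝒞.errorSet := by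
  have h0 : 𝒞.codeword 0 = 1 := by
    have h := 𝒞.codeword_add 0 0
    rwa [add_zero, left_eq_mul] at h
  constructor
  · intro h p hp hp0 hmem
    refine h p 0 hp (fun _ _ => rfl) hp0 1 (one_mem _) _ hmem ?_
    rw [h0, one_mul, mul_one]
  · intro h p q hp hq hpq e he f hf hef
    refine h (p + q) (fun i hi => by simp [hp i hi, hq i hi]) (fun h1 => hpq ?_) ?_
    · calc p = p + (q + q) := by rw [add_self_eq_zero_label, add_zero]
        _ = q := by rw [← add_assoc, h1, zero_add]
    · have h2 : 𝒞.codeword (p + q) = e⁻¹ * f := by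
        have h3 : 𝒞.codeword q * 𝒞.codeword q = 1 := by
          rw [← codeword_add, add_self_eq_zero_label, h0]
        rw [codeword_add, eq_inv_mul_iff_mul_eq, ← mul_assoc, hef, mul_assoc, h3, mul_one]
      rw [h2]
      exact mul_mem (inv_mem he) hf

/-- The eigenvalue of `pauliTensor (evolvedLabel j)` selected by the outcome `m j`; it differs from
`m j` by the sign relating that operator to the time-evolved measured operator. -/
def outcomePhase (m : Fin τ → ℤˣ) (j : Fin τ) : ℂ := ((m j : ℤ) : ℂ) * 𝒞.evolvedPhase j

theorem outcomePhase_mul_self (m : Fin τ → ℤˣ) (j : Fin τ) :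
    𝒞.outcomePhase m j * 𝒞.outcomePhase m j = 1 := by
  have h : ((m j : ℤ) : ℂ) * ((m j : ℤ) : ℂ) = 1 := by
    rcases Int.units_eq_one_or (m j) with h | h <;> simp [h]
  rw [outcomePhase, mul_mul_mul_comm, h, evolvedPhase_mul_self, one_mul]

theorem kraus_eq (m : Fin τ → ℤˣ) : 𝒞.kraus m =
    projectorProduct 𝒞.evolvedLabel (𝒞.outcomePhase m) * (List.ofFn 𝒞.gate).reverse.prod := by
  rw [kraus, prod_reverse_ofFn_mul _ _ fun j => (𝒞.gate_clifford j).1, projectorProduct]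
  congr 4
  funext j
  have h := 𝒞.evolved_eq j
  rw [evolved] at h
  change 𝒞.laterGates j * _ * (𝒞.laterGates j)ᴴ = _
  rw [projector, pauliProjector, mul_smul_comm, smul_mul_assoc, mul_add, add_mul, mul_one,
    mul_smul_comm, smul_mul_assoc, h, mul_conjTranspose_self_of_mem (𝒞.isClifford_laterGates j).1,
    outcomePhase, smul_smul]

theorem kraus_mul_maximallyMixed_mul (m : Fin τ → ℤˣ) :
    𝒞.kraus m * maximallyMixed n * (𝒞.kraus m)ᴴ = ((2 : ℂ) ^ n)⁻¹ •
      (projectorProduct 𝒞.evolvedLabel (𝒞.outcomePhase m) *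
        (projectorProduct 𝒞.evolvedLabel (𝒞.outcomePhase m))ᴴ) := by
  have hV : IsClifford (List.ofFn 𝒞.gate).reverse.prod := by
    refine isClifford_list_prod fun U hU => ?_
    obtain ⟨i, rfl⟩ := (List.mem_ofFn' _ _).1 (List.mem_reverse.1 hU)
    exact 𝒞.gate_clifford i
  rw [maximallyMixed, mul_smul_comm, mul_one, smul_mul_assoc, kraus_eq, Matrix.conjTranspose_mul,
    mul_assoc, ← mul_assoc _ _ (projectorProduct _ _)ᴴ, mul_conjTranspose_self_of_mem hV.1, one_mul]

theorem trace_eq_prob (m : Fin τ → ℤˣ) :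
    (𝒞.kraus m * maximallyMixed n * (𝒞.kraus m)ᴴ).trace = 𝒞.prob m := by
  have h := Matrix.isHermitian_mul_mul_conjTranspose (𝒞.kraus m) (maximallyMixed_isHermitian n)
  have h1 := congrArg Matrix.trace h.eq
  rw [Matrix.trace_conjTranspose] at h1
  exact (Complex.conj_eq_iff_re.1 h1).symm

theorem trace_outputState {m : Fin τ → ℤˣ} (hm : 𝒞.prob m ≠ 0) :
    (𝒞.outputState m).trace = 1 := by
  rw [outputState, Matrix.trace_smul, trace_eq_prob, smul_eq_mul, Complex.ofReal_inv]
  exact inv_mul_cancel₀ (Complex.ofReal_ne_zero.2 hm)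

theorem exists_outputState_eq {m : Fin τ → ℤˣ} (hm : 𝒞.prob m ≠ 0) :
    ∃ c : ℂ, c ≠ 0 ∧ 𝒞.outputState m =
      c • (projectorProduct 𝒞.evolvedLabel (𝒞.outcomePhase m) *
        (projectorProduct 𝒞.evolvedLabel (𝒞.outcomePhase m))ᴴ) := by
  refine ⟨_, mul_ne_zero (Complex.ofReal_ne_zero.2 (inv_ne_zero hm))
    (inv_ne_zero (pow_ne_zero n two_ne_zero)), ?_⟩
  rw [outputState, kraus_mul_maximallyMixed_mul, smul_smul]

theorem isStabilizerState_outputState {m : Fin τ → ℤˣ} (hm : 𝒞.prob m ≠ 0) :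
    IsStabilizerState (𝒞.outputState m) := by
  obtain ⟨c, hc, h⟩ := 𝒞.exists_outputState_eq hm
  rw [h]
  exact (isStabilizerState_projectorProduct _ (𝒞.outcomePhase_mul_self m)).smul hc

/-- The link between the dual code and the output state: lying in the error set is, for the codeword
of a Pauli operator, the same as commuting of the operator with all stabilizers of the state. -/
theorem commutesWithStabilizer_outputState {m : Fin τ → ℤˣ} (hm : 𝒞.prob m ≠ 0)
    (p : PauliString n) :
    CommutesWithStabilizer (𝒞.outputState m) p ↔ 𝒞.codeword p ∈ 𝒞.errorSet := by
  obtain ⟨c, hc, h⟩ := 𝒞.exists_outputState_eq hm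
  have h0 : projectorProduct 𝒞.evolvedLabel (𝒞.outcomePhase m) ≠ 0 := by
    intro h0
    have h1 := 𝒞.trace_outputState hm
    rw [h, h0] at h1
    simp at h1
  rw [CommutesWithStabilizer, h, stabilizer_smul hc, mem_errorSet]
  simp only [codeword_apply]
  exact commutesWithStabilizer_projectorProduct _ (𝒞.outcomePhase_mul_self m) h0 p

end Circuit

end Circuit

end MonitoredClifford

end

theorem theorem1 {n τ : ℕ} (𝒞 : MonitoredClifford.Circuit n τ) (A : Finset (Fin n))
    (m : Fin τ → ℤˣ) (hm : 𝒞.prob m ≠ 0) :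
    (MonitoredClifford.mutualInformation A (𝒞.outputState m) (𝒞.outputState_isHermitian m)
        = 2 * (A.card : ℝ) ↔ 𝒞.FullyRecoverable A) ∧
      (𝒞.FullyRecoverable A ↔
        ∀ p : MonitoredClifford.PauliString n, MonitoredClifford.SupportedOn A p → p ≠ 0 →
          𝒞.codeword p ∉ 𝒞.errorSet) := by
  refine ⟨?_, 𝒞.fullyRecoverable_iff A⟩
  rw [𝒞.fullyRecoverable_iff A, MonitoredClifford.mutualInformation_eq_iff
    (𝒞.isStabilizerState_outputState hm) (𝒞.trace_outputState hm)]
  simp only [𝒞.commutesWithStabilizer_outputState hm]
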